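/- Let $k,c,n$ be non-negative integers with $k+c\le n$, and let $U$ be an $n$-qubit Clifford unitary (conjugation by $U$ preserves the $n$-fold Pauli group). Consider the entanglement-assisted quantum error-correcting (EAQEC) code that encodes a $k$-qubit state $|\psi\rangle$ as $$(U\otimes I_B)\bigl(|\psi\rangle\otimes|\Phi_+\rangle^{\otimes c}\otimes|0\rangle^{\otimes n-k-c}\bigr),\qquad |\Phi_+\rangle=\tfrac1{\sqrt2}(|00\rangle+|11\rangle),$$ where Alice holds $n$ qubits (the $k$ information qubits, one half of each ebit, and the ancillas) and Bob holds the other halves of the $c$ ebits. Put $g'_i=UZ_iU^\dagger$ and $h'_i=UX_iU^\dagger$. The encoded states are stabilized by the generators $g'_{k+j}\otimes Z_j$ and $h'_{k+j}\otimes X_j$ ($1\le j\le c$) and $g'_i\otimes I$ ($k+c<i\le n$); call these $2c+(n-k-c)=n-k+c$ generators $\gamma_1,\dots,\gamma_{n-k+c}$. Let $\mathcal S_I=\langle g'_{k+c+1},\dots,g'_n\rangle$ be the isotropic subgroup of the simplified stabilizer group. A Pauli operator $E$ on Alice's qubits has syndrome $s\in\{0,1\}^{n-k+c}$ if $s_j=0$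 exactly when $E\otimes I_B$ commutes with $\gamma_j$. Let $T=\{E_s\}$ be a set of syndrome representatives on Alice's qubits: for each $s\in\{0,1\}^{n-k+c}$, $E_s\in\{I,X,Y,Z\}^{\otimes n}$ has syndrome $s$, and $E_0=I$. Let $\mathcal U$ be the encoding channel, and let $\mathcal D$ be the decoding channel that measures the syndrome with the projectors $P_s=\prod_j\frac{I+(-1)^{s_j}\gamma_j}{2}$, applies $E_s\otimes I_B$ for outcome $s$, applies $U^\dagger\otimes I_B$, and traces out all qubits but the $k$ information qubits. Let $\mathcal N_A=T_p^{\otimes n}$, where $T_p(\rho)=(1-\frac34p)\rho+\frac p4(X\rho X+Y\rho Y+Z\rho Z)$ and $0\le p\le 1$, and let $\mathcal N_A\otimes I_B$ be the noise (Bob's ebits are noiseless). For a channel $\mathcal E$ on an $m$-dimensional space, the channel fidelity is $F_C(\mathcal E)=\langle\psi|(I\otimes\mathcal E)(|\psi\rangle\langle\psi|)|\psi\rangle$ with $|\psi\rangle=m^{-1/2}\sum_j|j\rangle|j\rangle$. Then $$F_C\bigl(\mathcal D\,(\mathcal N_A\otimes I_B)\,\mathcal U\bigr)=\sum_{w=0}^n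 a_w\,q_w,\qquad q_w=\Bigl(1-\frac34p\Bigr)^{n-w}\Bigl(\frac14p\Bigr)^w,$$ where $a_w$ is the number of operators of weight $w$ (number of non-identity tensor factors) in $T\times\mathcal S_I=\{hg:h\in T,\ g\in\mathcal S_I\}$, operators being counted up to phase. That is, the channel fidelity is the weight enumerator of $T\times\mathcal S_I$, a polynomial in the $q_w$. -/

import Mathlib

open scoped Kronecker Matrix

namespace EAQEC

noncomputable section

/-! ### Pauli operators on a finite register of qubits -/

/-- The four single-qubit Pauli letters. -/
inductive PauliLetter
  | I
  | X
  | Y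
  | Z
  deriving DecidableEq

instance : Fintype PauliLetter where
  elems := {PauliLetter.I, PauliLetter.X, PauliLetter.Y, PauliLetter.Z}
  complete L := by cases L <;> simp

/-- The single-qubit Pauli matrices. -/
def PauliLetter.mat : PauliLetter → Matrix (Fin 2) (Fin 2) ℂ
  | .I => 1
  | .X => !![0, 1; 1, 0]
  | .Y => !![0, -Complex.I; Complex.I, 0]
  | .Z => !![1, 0; 0, -1]

/-- Labels of the standard basis of a register of qubits indexed by `ι`. -/
abbrev Bits (ι : Type) : Type := ι → Fin 2

/-- Operators (square complex matrices) on the space with standard basis indexed by `α`. -/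
abbrev Op (α : Type) : Type := Matrix α α ℂ

/-- The tensor product `⨂ i, M i` of one-qubit matrices, one for each qubit of the register. -/
def tensorPi {ι : Type} [Fintype ι] (M : ι → Matrix (Fin 2) (Fin 2) ℂ) : Op (Bits ι) :=
  Matrix.of fun x y => ∏ i, M i (x i) (y i)

/-- A Pauli error operator without phase, `M₁ ⊗ ⋯ ⊗ Mₙ` with `Mⱼ ∈ {I, X, Y, Z}`, is recorded by
its word of letters. -/
abbrev PauliWord (ι : Type) : Type := ι → PauliLetter

/-- The operator of a Pauli word. -/
def pauliOp {ι : Type} [Fintype ι] (P : PauliWord ι) : Op (Bits ι) :=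
  tensorPi fun i => (P i).mat

/-- The weight: the number of tensor factors that differ from the identity. -/
def weight {ι : Type} [Fintype ι] (P : PauliWord ι) : ℕ :=
  (Finset.univ.filter fun i => P i ≠ PauliLetter.I).card

/-- The word with the letter `L` at qubit `i` and identities elsewhere. -/
def wordAt {ι : Type} [DecidableEq ι] (i : ι) (L : PauliLetter) : PauliWord ι :=
  Function.update (fun _ => PauliLetter.I) i L

theorem tensorPi_mul {ι : Type} [Fintype ι] [DecidableEq ι]
    (M N : ι → Matrix (Fin 2) (Fin 2) ℂ) :
    tensorPi M * tensorPi N = tensorPi fun i => M i * N i := by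
  ext x y
  simp only [tensorPi, Matrix.mul_apply, Matrix.of_apply, Finset.prod_univ_sum,
    Fintype.piFinset_univ, Finset.prod_mul_distrib]

theorem tensorPi_one {ι : Type} [Fintype ι] [DecidableEq ι] :
    tensorPi (fun _ : ι => (1 : Matrix (Fin 2) (Fin 2) ℂ)) = 1 := by
  ext x y
  by_cases h : x = y
  · subst h
    simp [tensorPi]
  · obtain ⟨i, hi⟩ := Function.ne_iff.mp h
    rw [Matrix.one_apply_ne h]
    simp only [tensorPi, Matrix.of_apply]
    exact Finset.prod_eq_zero (Finset.mem_univ i) (Matrix.one_apply_ne hi)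

theorem tensorPi_smul {ι : Type} [Fintype ι] (z : ι → ℂ)
    (M : ι → Matrix (Fin 2) (Fin 2) ℂ) :
    tensorPi (fun i => z i • M i) = (∏ i, z i) • tensorPi M := by
  ext x y
  simp [tensorPi, Finset.prod_mul_distrib]

theorem PauliLetter.mat_mul_self (L : PauliLetter) : L.mat * L.mat = 1 := by
  cases L <;> ext i j <;> fin_cases i <;> fin_cases j <;>
    simp [PauliLetter.mat, Matrix.mul_apply]

theorem PauliLetter.star_mat (L : PauliLetter) : star L.mat = L.mat := by
  cases L <;> ext i j <;> fin_cases i <;> fin_cases j <;>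
    simp [PauliLetter.mat, Matrix.star_apply]

theorem PauliLetter.mat_mul (L M : PauliLetter) :
    ∃ z : ℂ, z ^ 4 = 1 ∧ ∃ N : PauliLetter, L.mat * M.mat = z • N.mat := by
  have hI : Complex.I ^ 4 = 1 := Complex.I_pow_four
  have hI' : (-Complex.I) ^ 4 = 1 := by rw [Even.neg_pow (by decide), hI]
  cases L <;> cases M
  · exact ⟨1, by simp, .I, by simp [PauliLetter.mat]⟩
  · exact ⟨1, by simp, .X, by simp [PauliLetter.mat]⟩
  · exact ⟨1, by simp, .Y, by simp [PauliLetter.mat]⟩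
  · exact ⟨1, by simp, .Z, by simp [PauliLetter.mat]⟩
  · exact ⟨1, by simp, .X, by simp [PauliLetter.mat]⟩
  · exact ⟨1, by simp, .I, by rw [PauliLetter.mat_mul_self]; simp [PauliLetter.mat]⟩
  · exact ⟨Complex.I, hI, .Z, by simp [PauliLetter.mat]⟩
  · exact ⟨-Complex.I, hI', .Y, by simp [PauliLetter.mat]⟩
  · exact ⟨1, by simp, .Y, by simp [PauliLetter.mat]⟩
  · exact ⟨-Complex.I, hI', .Z, by simp [PauliLetter.mat]⟩
  · exact ⟨1, by simp, .I, by rw [PauliLetter.mat_mul_self]; simp [PauliLetter.mat]⟩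
  · exact ⟨Complex.I, hI, .X, by simp [PauliLetter.mat]⟩
  · exact ⟨1, by simp, .Z, by simp [PauliLetter.mat]⟩
  · exact ⟨Complex.I, hI, .Y, by simp [PauliLetter.mat]⟩
  · exact ⟨-Complex.I, hI', .X, by simp [PauliLetter.mat]⟩
  · exact ⟨1, by simp, .I, by rw [PauliLetter.mat_mul_self]; simp [PauliLetter.mat]⟩

theorem pauliOp_mul_self {ι : Type} [Fintype ι] [DecidableEq ι] (P : PauliWord ι) :
    pauliOp P * pauliOp P = 1 := by
  simp only [pauliOp, tensorPi_mul, PauliLetter.mat_mul_self, tensorPi_one]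

theorem star_pauliOp {ι : Type} [Fintype ι] (P : PauliWord ι) :
    star (pauliOp P) = pauliOp P := by
  ext x y
  simp only [pauliOp, tensorPi, Matrix.star_apply, Matrix.of_apply, star_prod]
  refine Finset.prod_congr rfl fun i _ => ?_
  conv_rhs => rw [← PauliLetter.star_mat, Matrix.star_apply]

theorem pauliOp_mul {ι : Type} [Fintype ι] [DecidableEq ι] (P Q : PauliWord ι) :
    ∃ z : ℂ, z ^ 4 = 1 ∧ ∃ R : PauliWord ι, pauliOp P * pauliOp Q = z • pauliOp R := by
  choose z hz R hR using fun i => PauliLetter.mat_mul (P i) (Q i)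
  refine ⟨∏ i, z i, ?_, R, ?_⟩
  · rw [← Finset.prod_pow]
    exact Finset.prod_eq_one fun i _ => hz i
  · simp only [pauliOp, tensorPi_mul, hR, tensorPi_smul]

/-- The group of unitary operators on a register of qubits. -/
abbrev Unitaries (ι : Type) [Fintype ι] [DecidableEq ι] : Type :=
  Matrix.unitaryGroup (Bits ι) ℂ

/-- A Pauli word as a unitary operator. -/
def pauliUnitary {ι : Type} [Fintype ι] [DecidableEq ι] (P : PauliWord ι) : Unitaries ι :=
  ⟨pauliOp P, by
    rw [Matrix.mem_unitaryGroup_iff, star_pauliOp, pauliOp_mul_self]⟩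

/-- The Pauli group of the register: all `z • P` with `z ∈ {1, -1, i, -i}` and `P` a Pauli word. -/
def pauliGroup (ι : Type) [Fintype ι] [DecidableEq ι] : Subgroup (Unitaries ι) where
  carrier := {u | ∃ z : ℂ, z ^ 4 = 1 ∧ ∃ P : PauliWord ι, (u : Op (Bits ι)) = z • pauliOp P}
  one_mem' := ⟨1, by simp, fun _ => PauliLetter.I, by
    simp [pauliOp, PauliLetter.mat, tensorPi_one]⟩
  mul_mem' := by
    rintro u v ⟨z, hz, P, hP⟩ ⟨w, hw, Q, hQ⟩
    obtain ⟨t, ht, R, hR⟩ := pauliOp_mul P Q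
    refine ⟨z * w * t, by rw [mul_pow, mul_pow, hz, hw, ht]; simp, R, ?_⟩
    rw [Submonoid.coe_mul, hP, hQ, Matrix.smul_mul, Matrix.mul_smul, hR, smul_smul, smul_smul,
      mul_assoc]
  inv_mem' := by
    rintro u ⟨z, hz, P, hP⟩
    refine ⟨star z, by rw [← star_pow, hz, star_one], P, ?_⟩
    rw [Matrix.UnitaryGroup.inv_val, hP, star_smul, star_pauliOp]

/-- A Clifford unitary: conjugation by it leaves the Pauli group invariant. -/
def IsClifford {ι : Type} [Fintype ι] [DecidableEq ι] (U : Unitaries ι) : Prop :=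
  ∀ g ∈ pauliGroup ι, U * g * U⁻¹ ∈ pauliGroup ι

/-! ### Channels and channel fidelity -/

/-- Linear maps on operators; quantum channels are among these. -/
abbrev SuperOp (α β : Type) : Type := Op α →ₗ[ℂ] Op β

/-- The map `ρ ↦ ∑ i, Kᵢ ρ Kᵢ†` with operation elements `Kᵢ`. -/
def krausMap {α β σ : Type} [Fintype α] [Fintype σ] (K : σ → Matrix β α ℂ) : SuperOp α β where
  toFun ρ := ∑ i, K i * ρ * (K i)ᴴ
  map_add' ρ τ := by simp [Matrix.mul_add, Matrix.add_mul, Finset.sum_add_distrib]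
  map_smul' z ρ := by simp [Finset.smul_sum]

/-- The map `id ⊗ Φ`, on operators of a bipartite space. -/
def idTensor {α β : Type} (γ : Type) (Φ : SuperOp α β) : SuperOp (γ × α) (γ × β) where
  toFun ρ := Matrix.of fun x y => Φ (Matrix.of fun u v => ρ (x.1, u) (y.1, v)) x.2 y.2
  map_add' ρ τ := by
    ext x y
    exact congrFun (congrFun (Φ.map_add (Matrix.of fun u v => ρ (x.1, u) (y.1, v))
      (Matrix.of fun u v => τ (x.1, u) (y.1, v))) x.2) y.2
  map_smul' z ρ := by
    ext x y
    exact congrFun (congrFun (Φ.map_smul z (Matrix.of fun u v => ρ (x.1, u) (y.1, v))) x.2) y.2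

/-- The map `Φ ⊗ id`, on operators of a bipartite space. -/
def tensorId {α β : Type} (Φ : SuperOp α β) (γ : Type) : SuperOp (α × γ) (β × γ) where
  toFun ρ := Matrix.of fun x y => Φ (Matrix.of fun u v => ρ (u, x.2) (v, y.2)) x.1 y.1
  map_add' ρ τ := by
    ext x y
    exact congrFun (congrFun (Φ.map_add (Matrix.of fun u v => ρ (u, x.2) (v, y.2))
      (Matrix.of fun u v => τ (u, x.2) (v, y.2))) x.1) y.1
  map_smul' z ρ := by
    ext x y
    exact congrFun (congrFun (Φ.map_smul z (Matrix.of fun u v => ρ (u, x.2) (v, y.2))) x.1) y.1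

/-- The maximally entangled vector `m^(-1/2) ∑ j, |j⟩|j⟩`. -/
def maxEntangled (α : Type) [Fintype α] [DecidableEq α] : α × α → ℂ :=
  fun x => if x.1 = x.2 then ((1 / Real.sqrt (Fintype.card α) : ℝ) : ℂ) else 0

/-- The channel fidelity `⟨ψ| (id ⊗ Φ)(|ψ⟩⟨ψ|) |ψ⟩`, with `ψ` the maximally entangled vector. -/
def channelFidelity {α : Type} [Fintype α] [DecidableEq α] (Φ : SuperOp α α) : ℂ :=
  star (maxEntangled α) ⬝ᵥ
    (idTensor α Φ (Matrix.vecMulVec (maxEntangled α) (star (maxEntangled α))) *ᵥ maxEntangled α)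

/-- The single-qubit depolarizing channel
`ρ ↦ (1 - 3p/4) ρ + (p/4) (X ρ X + Y ρ Y + Z ρ Z)`. -/
def depolarizing (p : ℝ) : SuperOp (Fin 2) (Fin 2) where
  toFun ρ := ((1 - 3 / 4 * p : ℝ) : ℂ) • ρ + ((p / 4 : ℝ) : ℂ) •
    (PauliLetter.X.mat * ρ * PauliLetter.X.mat + PauliLetter.Y.mat * ρ * PauliLetter.Y.mat +
      PauliLetter.Z.mat * ρ * PauliLetter.Z.mat)
  map_add' ρ τ := by
    simp only [Matrix.mul_add, Matrix.add_mul, smul_add]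
    abel
  map_smul' z ρ := by
    simp only [Matrix.mul_smul, Matrix.smul_mul, smul_add, RingHom.id_apply,
      smul_comm _ z]

/-- The tensor power `Φ^{⊗ι}` of a one-qubit map: the linear map that sends
`⨂ i, |yᵢ⟩⟨y'ᵢ|` to `⨂ i, Φ(|yᵢ⟩⟨y'ᵢ|)`. -/
def tensorPower (ι : Type) [Fintype ι] [DecidableEq ι] (Φ : SuperOp (Fin 2) (Fin 2)) :
    SuperOp (Bits ι) (Bits ι) where
  toFun ρ := ∑ y, ∑ y', ρ y y' • tensorPi fun i => Φ (Matrix.single (y i) (y' i) 1)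
  map_add' ρ τ := by
    simp only [Matrix.add_apply, add_smul, Finset.sum_add_distrib]
  map_smul' z ρ := by
    simp only [Matrix.smul_apply, smul_eq_mul, mul_smul, Finset.smul_sum, RingHom.id_apply]

/-! ### Entanglement-assisted codes -/

section Code

variable {k c a : ℕ}

/-- Alice's `n = k + c + a` qubits: `k` information qubits, her halves of `c` ebits,
and `a = n - k - c` ancillas. -/
abbrev AliceQubit (k c a : ℕ) : Type := Fin k ⊕ Fin c ⊕ Fin a

/-- Basis labels of the joint space of Alice's `n` qubits and of Bob's halves of the `c` ebits. -/
abbrev Joint (k c a : ℕ) : Type := Bits (AliceQubit k c a) × Bits (Fin c)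

/-- The amplitudes of the ebit `(|00⟩ + |11⟩)/√2`. -/
def ebit (x y : Fin 2) : ℂ := if x = y then ((1 / Real.sqrt 2 : ℝ) : ℂ) else 0

/-- The isometry `|ψ⟩ ↦ |ψ⟩ ⊗ |Φ₊⟩^{⊗c} ⊗ |0⟩^{⊗a}`. -/
def initialState (k c a : ℕ) : Matrix (Joint k c a) (Bits (Fin k)) ℂ :=
  Matrix.of fun x m =>
    (if (fun i => x.1 (Sum.inl i)) = m then 1 else 0) *
    (∏ j, ebit (x.1 (Sum.inr (Sum.inl j))) (x.2 j)) *
    (if (fun i => x.1 (Sum.inr (Sum.inr i))) = 0 then 1 else 0)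

/-- The encoding channel: conjugation by `(U ⊗ I)(|ψ⟩ ⊗ |Φ₊⟩^{⊗c} ⊗ |0⟩^{⊗a})`. -/
def encoder (U : Unitaries (AliceQubit k c a)) : SuperOp (Bits (Fin k)) (Joint k c a) :=
  krausMap fun _ : Unit =>
    ((U : Op (Bits (AliceQubit k c a))) ⊗ₖ (1 : Op (Bits (Fin c)))) * initialState k c a

/-- The conjugate `U P U†` on Alice's side of the one-qubit Pauli operator `L` at qubit `i`;
the simplified generators are `g'ᵢ = U Zᵢ U†` and `h'ᵢ = U Xᵢ U†`. -/
def conjPauli (U : Unitaries (AliceQubit k c a)) (i : AliceQubit k c a) (L : PauliLetter) :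
    Unitaries (AliceQubit k c a) :=
  U * pauliUnitary (wordAt i L) * U⁻¹

/-- The isotropic subgroup of the simplified stabilizer group: it is generated by the `g'ᵢ` with
`i` ranging over the ancillas. -/
def isotropicSubgroup (U : Unitaries (AliceQubit k c a)) :
    Subgroup (Unitaries (AliceQubit k c a)) :=
  Subgroup.closure
    (Set.range fun i : Fin a => conjPauli U (Sum.inr (Sum.inr i)) PauliLetter.Z)

/-- Labels of the stabilizer generators: `g` and `h` for each ebit, `g` for each ancilla. -/
abbrev GenLabel (c a : ℕ) : Type := Fin c ⊕ Fin c ⊕ Fin a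

/-- The generators of the stabilizer group of the encoded states on all `n + c` qubits:
`g'ⱼ ⊗ Zⱼ` and `h'ⱼ ⊗ Xⱼ` for the ebits, `g'ᵢ ⊗ I` for the ancillas. -/
def generator (U : Unitaries (AliceQubit k c a)) : GenLabel c a → Op (Joint k c a)
  | Sum.inl j =>
      (conjPauli U (Sum.inr (Sum.inl j)) PauliLetter.Z : Op (Bits (AliceQubit k c a))) ⊗ₖ
        pauliOp (wordAt j PauliLetter.Z)
  | Sum.inr (Sum.inl j) =>
      (conjPauli U (Sum.inr (Sum.inl j)) PauliLetter.X : Op (Bits (AliceQubit k c a))) ⊗ₖ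
        pauliOp (wordAt j PauliLetter.X)
  | Sum.inr (Sum.inr i) =>
      (conjPauli U (Sum.inr (Sum.inr i)) PauliLetter.Z : Op (Bits (AliceQubit k c a))) ⊗ₖ
        (1 : Op (Bits (Fin c)))

/-- Error syndromes: one bit for each stabilizer generator. -/
abbrev Syndrome (c a : ℕ) : Type := GenLabel c a → Fin 2

/-- An error operator on Alice's qubits, acting on the joint space as `E ⊗ I`. -/
def aliceOp (E : PauliWord (AliceQubit k c a)) : Op (Joint k c a) :=
  pauliOp E ⊗ₖ (1 : Op (Bits (Fin c)))

/-- `E ⊗ I` has syndrome `s`: `s j = 0` exactly if it commutes with the `j`-th generator. -/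
def HasSyndrome (U : Unitaries (AliceQubit k c a)) (E : PauliWord (AliceQubit k c a))
    (s : Syndrome c a) : Prop :=
  ∀ j, s j = 0 ↔ Commute (aliceOp E) (generator U j)

/-- A choice of syndrome representatives among the errors on Alice's qubits: an operator with
syndrome `s` for each `s`, and the identity for `s = 0`. -/
def IsSyndromeReps (U : Unitaries (AliceQubit k c a))
    (T : Syndrome c a → PauliWord (AliceQubit k c a)) : Prop :=
  (∀ s, HasSyndrome U (T s) s) ∧ T 0 = fun _ => PauliLetter.I

/-- The factor `(I + (-1)^{sⱼ} gⱼ)/2`. -/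
def projFactor (U : Unitaries (AliceQubit k c a)) (s : Syndrome c a) (j : GenLabel c a) :
    Op (Joint k c a) :=
  (1 / 2 : ℂ) • (1 + (-1 : ℂ) ^ (s j : ℕ) • generator U j)

/-- The syndrome projector `P_s = ∏ j, (I + (-1)^{sⱼ} gⱼ)/2`. -/
def syndromeProj (U : Unitaries (AliceQubit k c a)) (s : Syndrome c a) : Op (Joint k c a) :=
  (List.ofFn fun j : Fin c => projFactor U s (Sum.inl j)).prod *
  (List.ofFn fun j : Fin c => projFactor U s (Sum.inr (Sum.inl j))).prod *
  (List.ofFn fun i : Fin a => projFactor U s (Sum.inr (Sum.inr i))).prod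

/-- The partial trace over all qubits but the information qubits. -/
def traceOut (k c a : ℕ) : SuperOp (Joint k c a) (Bits (Fin k)) where
  toFun ρ := Matrix.of fun m m' =>
    ∑ u : Bits (Fin c ⊕ Fin a), ∑ y : Bits (Fin c), ρ (Sum.elim m u, y) (Sum.elim m' u, y)
  map_add' ρ τ := by
    ext m m'
    simp [Finset.sum_add_distrib]
  map_smul' z ρ := by
    ext m m'
    simp [Finset.mul_sum]

/-- The decoding channel: measure the syndrome, apply the representative of the outcome, undo the
encoding unitary `U ⊗ I`, and discard all qubits but the information qubits. (A further unitary
that disentangles the ebits would act on discarded qubits only.) -/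
def decoder (U : Unitaries (AliceQubit k c a))
    (T : Syndrome c a → PauliWord (AliceQubit k c a)) : SuperOp (Joint k c a) (Bits (Fin k)) :=
  traceOut k c a ∘ₗ krausMap fun s : Syndrome c a =>
    ((U : Op (Bits (AliceQubit k c a))) ⊗ₖ (1 : Op (Bits (Fin c))))ᴴ *
      aliceOp (T s) * syndromeProj U s

/-- The noise `N_A ⊗ I_B`: independent depolarizing channels of rate `p` on Alice's qubits, the
identity channel on Bob's. -/
def aliceNoise (k c a : ℕ) (p : ℝ) : SuperOp (Joint k c a) (Joint k c a) :=
  tensorId (tensorPower (AliceQubit k c a) (depolarizing p)) (Bits (Fin c))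

/-- The set `T × S_I` of products `h g`, up to phase, with `h ∈ T` and `g ∈ S_I`. -/
def repsTimesIsotropic (U : Unitaries (AliceQubit k c a))
    (T : Syndrome c a → PauliWord (AliceQubit k c a)) : Set (PauliWord (AliceQubit k c a)) :=
  {E | ∃ s, ∃ g ∈ isotropicSubgroup U, ∃ z : ℂ, z ^ 4 = 1 ∧
    pauliOp (T s) * (g : Op (Bits (AliceQubit k c a))) = z • pauliOp E}

end Code

/-- The weight enumerator `∑ w, A_w q_w` of a set of Pauli words on `n` qubits, where `A_w` is the
number of its elements of weight `w`. -/
def weightEnumerator {ι : Type} [Fintype ι] (A : Set (PauliWord ι)) (q : ℕ → ℝ) : ℝ :=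
  ∑ w ∈ Finset.range (Fintype.card ι + 1), ({E ∈ A | weight E = w}.ncard : ℝ) * q w

/-- The probability `q_w = (1 - 3p/4)^{n-w} (p/4)^w` of an error of weight `w ≤ n`. -/
def errorProb (n : ℕ) (p : ℝ) (w : ℕ) : ℝ := (1 - 3 / 4 * p) ^ (n - w) * (1 / 4 * p) ^ w

end

end EAQEC

/-!
Depolarizing noise applies each Pauli word `E` with probability `q_{wt E}`
(`tensorPower_depolarizing_apply`), and the channel fidelity of a map in Kraus form on an
`m`-dimensional space is `m⁻²` times the sum of the squared moduli of the traces of its Kraus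
operators (`channelFidelity_eq`, `sum_traceOut_single`). So the fidelity is a sum over `E`
and over the measured syndromes `s` (`channelFidelity_code_eq_sum`).

The generators fix the encoded states, hence `E` shifts their eigenvalues by its syndrome, and only
the outcome `s = syndromeOf U E` occurs (`syndromeProj_mul_error`). Then `E_s E` commutes with all
generators; by the Clifford property it is, up to phase, `U Q U†` for a Pauli word `Q`
(`exists_residual`), and commutation makes `Q` trivial on the ebits and `I` or `Z` on each ancilla
(`commute_genWord_iff`). Ancillas in `|0⟩` do not see the `Z`s, so what is left is the restriction of
`Q` to the information qubits, whose trace is `m` if it is the identity and `0` otherwise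
(`traceWeight_residual`).

Finally, the isotropic subgroup is the set of `U Q U†` with `Q` a product of ancilla `Z`s
(`mem_isotropicSubgroup_iff`). So `E` contributes, with `q_{wt E}`, exactly if `E_s E` lies in it up
to phase, that is, if `E` lies in `T × S_I` (`mem_repsTimesIsotropic_iff`).
-/

open scoped Kronecker Matrix

namespace EAQEC

/-! ### Commutation and uniqueness of Pauli words -/

/-- The sign `±1` in `L M = ± M L` for single-qubit Pauli letters. -/
def PauliLetter.sign (L M : PauliLetter) : ℂ :=
  if L = .I ∨ M = .I ∨ L = M then 1 else -1

theorem PauliLetter.mat_mul_comm_sign (L M : PauliLetter) :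
    L.mat * M.mat = L.sign M • (M.mat * L.mat) := by
  cases L <;> cases M <;> simp [PauliLetter.mat, PauliLetter.sign]

theorem PauliLetter.sign_eq (L M : PauliLetter) : L.sign M = 1 ∨ L.sign M = -1 := by
  unfold PauliLetter.sign; split_ifs <;> simp

theorem PauliLetter.trace_mat (L : PauliLetter) :
    L.mat.trace = if L = .I then 2 else 0 := by
  cases L <;> simp [PauliLetter.mat, Matrix.trace_fin_two]

theorem PauliLetter.trace_mat_mul (L M : PauliLetter) :
    (L.mat * M.mat).trace = if L = M then 2 else 0 := by
  cases L <;> cases M <;> simp [PauliLetter.mat, Matrix.trace_fin_two, one_add_one_eq_two]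

section Words

variable {ι : Type} [Fintype ι] [DecidableEq ι]

theorem trace_tensorPi (M : ι → Matrix (Fin 2) (Fin 2) ℂ) :
    (tensorPi M).trace = ∏ i, (M i).trace := by
  simp only [Matrix.trace, tensorPi, Matrix.diag_apply, Matrix.of_apply, Finset.prod_univ_sum,
    Fintype.piFinset_univ]

theorem trace_pauliOp (P : PauliWord ι) :
    (pauliOp P).trace = if P = fun _ => .I then 2 ^ Fintype.card ι else 0 := by
  rw [pauliOp, trace_tensorPi]
  simp only [PauliLetter.trace_mat]
  split_ifs with h
  · simp [h]
  · obtain ⟨i, hi⟩ := Function.ne_iff.mp h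
    exact Finset.prod_eq_zero (Finset.mem_univ i) (if_neg hi)

theorem trace_pauliOp_mul (P Q : PauliWord ι) :
    (pauliOp P * pauliOp Q).trace = if P = Q then 2 ^ Fintype.card ι else 0 := by
  rw [pauliOp, pauliOp, tensorPi_mul, trace_tensorPi]
  simp only [PauliLetter.trace_mat_mul]
  split_ifs with h
  · simp [h]
  · obtain ⟨i, hi⟩ := Function.ne_iff.mp h
    exact Finset.prod_eq_zero (Finset.mem_univ i) (if_neg hi)

/-- A Pauli word is determined by its operator up to a scalar, because distinct words are
orthogonal for the trace form. -/
theorem eq_of_pauliOp_eq_smul {P Q : PauliWord ι} {z : ℂ} (h : pauliOp P = z • pauliOp Q) :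
    P = Q := by
  by_contra hne
  have h' := congrArg (fun M => (pauliOp P * M).trace) h
  simp [trace_pauliOp_mul, hne] at h'

theorem pauliOp_mul_comm_sign (P Q : PauliWord ι) :
    pauliOp P * pauliOp Q = (∏ i, (P i).sign (Q i)) • (pauliOp Q * pauliOp P) := by
  simp only [pauliOp, tensorPi_mul]
  rw [← tensorPi_smul]
  simp only [← PauliLetter.mat_mul_comm_sign]

theorem prod_sign_eq {ι : Type} [Fintype ι] (P Q : PauliWord ι) :
    ∏ i, (P i).sign (Q i) = 1 ∨ ∏ i, (P i).sign (Q i) = -1 := by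
  refine Finset.prod_induction _ (fun z : ℂ => z = 1 ∨ z = -1) ?_ (Or.inl rfl)
    fun i _ => PauliLetter.sign_eq _ _
  rintro x y (rfl | rfl) (rfl | rfl) <;> simp

theorem pauliOp_const_I : pauliOp (fun _ : ι => PauliLetter.I) = 1 := by
  simp [pauliOp, PauliLetter.mat, tensorPi_one]

theorem pauliOp_ne_zero (P : PauliWord ι) : pauliOp P ≠ 0 := by
  intro h
  have := pauliOp_mul_self P
  rw [h, zero_mul] at this
  exact zero_ne_one this

theorem commute_pauliOp_iff (P Q : PauliWord ι) :
    Commute (pauliOp P) (pauliOp Q) ↔ ∏ i, (P i).sign (Q i) = 1 := by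
  refine ⟨fun h => ?_, fun h => ?_⟩
  · obtain ⟨z, hz, R, hR⟩ := pauliOp_mul Q P
    have hz0 : z ≠ 0 := by rintro rfl; simp at hz
    have h1 := pauliOp_mul_comm_sign P Q
    rw [h.eq, hR, smul_smul] at h1
    have h2 := smul_left_injective ℂ (pauliOp_ne_zero R) h1
    exact (mul_eq_right₀ hz0).mp h2.symm
  · have := pauliOp_mul_comm_sign P Q
    rwa [h, one_smul] at this

theorem commute_pauliOp_wordAt_iff (P : PauliWord ι) (i : ι) (L : PauliLetter) :
    Commute (pauliOp P) (pauliOp (wordAt i L)) ↔ (P i).sign L = 1 := by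
  rw [commute_pauliOp_iff, Finset.prod_eq_single i]
  · simp [wordAt]
  · intro j _ hj
    simp [wordAt, Function.update_of_ne hj, PauliLetter.sign]
  · simp

theorem pauliGroup_finite : (pauliGroup ι : Set (Unitaries ι)).Finite := by
  have hroots : {z : ℂ | z ^ 4 = 1}.Finite := by
    refine ((Polynomial.nthRoots 4 (1 : ℂ)).toFinset.finite_toSet).subset fun z hz => ?_
    simpa [Polynomial.mem_nthRoots] using hz
  have him : ((fun x : ℂ × PauliWord ι => x.1 • pauliOp x.2) ''
      ({z : ℂ | z ^ 4 = 1} ×ˢ (Set.univ : Set (PauliWord ι)))).Finite :=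
    (hroots.prod Set.finite_univ).image _
  refine Set.Finite.of_finite_image (f := fun u : Unitaries ι => (u : Op (Bits ι)))
    (him.subset ?_) Subtype.val_injective.injOn
  rintro _ ⟨u, ⟨z, hz, P, hP⟩, rfl⟩
  exact ⟨(z, P), ⟨hz, trivial⟩, hP.symm⟩

theorem pauliUnitary_mem_pauliGroup (P : PauliWord ι) : pauliUnitary P ∈ pauliGroup ι :=
  ⟨1, by simp, P, by simp [pauliUnitary]⟩

/-- Conjugation by the inverse of a Clifford unitary preserves the Pauli group too, because the
Pauli group is finite. -/
theorem IsClifford.inv_mul_mul_mem {U : Unitaries ι} (hU : IsClifford U) {g : Unitaries ι}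
    (hg : g ∈ pauliGroup ι) : U⁻¹ * g * U ∈ pauliGroup ι := by
  have hinj : Set.InjOn (fun g => U * g * U⁻¹) (pauliGroup ι : Set (Unitaries ι)) := by
    intro x _ y _ h
    simpa using h
  have hsurj := ((pauliGroup_finite.injOn_iff_bijOn_of_mapsTo hU).mp hinj).surjOn
  obtain ⟨x, hx, rfl⟩ := hsurj hg
  simpa [mul_assoc] using hx

end Words

/-! ### The channel fidelity of a noisy channel in Kraus form -/

theorem channelFidelity_eq {α : Type} [Fintype α] [DecidableEq α] (Φ : SuperOp α α) :
    channelFidelity Φ =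
      ((Fintype.card α : ℂ) ^ 2)⁻¹ * ∑ i, ∑ j, Φ (Matrix.single i j 1) i j := by
  set r : ℂ := ((1 / Real.sqrt (Fintype.card α) : ℝ) : ℂ) with hr
  have hrr : r * r = (Fintype.card α : ℂ)⁻¹ := by
    rw [hr, ← Complex.ofReal_mul, div_mul_div_comm, Real.mul_self_sqrt (Nat.cast_nonneg _)]
    simp
  have hstar : star r = r := by rw [hr]; exact Complex.conj_ofReal _
  have hvec : ∀ x : α × α, maxEntangled α x = if x.1 = x.2 then r else 0 := fun x => rfl
  have hconj : (starRingEnd ℂ) r = r := hstar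
  clear_value r
  have hslice : ∀ i j : α, (Matrix.of fun u v =>
      Matrix.vecMulVec (maxEntangled α) (star (maxEntangled α)) (i, u) (j, v)) =
        (r * r) • Matrix.single i j (1 : ℂ) := by
    intro i j
    ext u v
    by_cases h1 : i = u <;> by_cases h2 : j = v <;>
      simp [Matrix.vecMulVec_apply, hvec, h1, h2, hconj]
  have hentry : ∀ x y : α × α, idTensor α Φ
      (Matrix.vecMulVec (maxEntangled α) (star (maxEntangled α))) x y =
        (r * r) * Φ (Matrix.single x.1 y.1 1) x.2 y.2 := by
    intro x y
    change Φ (Matrix.of fun u v =>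
      Matrix.vecMulVec (maxEntangled α) (star (maxEntangled α)) (x.1, u) (y.1, v)) x.2 y.2 = _
    rw [hslice, map_smul]
    rfl
  rw [channelFidelity, dotProduct]
  simp only [Matrix.mulVec, dotProduct, hentry, Pi.star_apply, hvec, apply_ite star, hstar,
    star_zero, Fintype.sum_prod_type, ite_mul, mul_ite, mul_zero, zero_mul, Finset.sum_ite_eq,
    Finset.mem_univ, if_true]
  rw [Finset.mul_sum]
  refine Finset.sum_congr rfl fun i _ => ?_
  rw [Finset.mul_sum, Finset.mul_sum]
  refine Finset.sum_congr rfl fun j _ => ?_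
  rw [pow_two, mul_inv, ← hrr]
  ring

/-- The probability that the single-qubit depolarizing channel applies the letter `L`. -/
noncomputable def letterProb (p : ℝ) (L : PauliLetter) : ℝ :=
  if L = .I then 1 - 3 / 4 * p else 1 / 4 * p

theorem depolarizing_apply (p : ℝ) (ρ : Op (Fin 2)) :
    depolarizing p ρ = ∑ L : PauliLetter, (letterProb p L : ℂ) • (L.mat * ρ * L.mat) := by
  have huniv : (Finset.univ : Finset PauliLetter) = {.I, .X, .Y, .Z} := rfl
  rw [huniv]
  simp only [Finset.sum_insert, Finset.mem_insert, Finset.mem_singleton, Finset.sum_singleton,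
    reduceCtorEq, or_self, not_false_eq_true, letterProb, if_true, if_false]
  change ((1 - 3 / 4 * p : ℝ) : ℂ) • ρ + ((p / 4 : ℝ) : ℂ) • (_ + _ + _) = _
  rw [show p / 4 = 1 / 4 * p by ring, smul_add, smul_add]
  simp only [PauliLetter.mat, Matrix.one_mul, Matrix.mul_one, add_assoc]

section Noise

variable {ι : Type} [Fintype ι] [DecidableEq ι]

theorem tensorPi_sum {σ : Type} [Fintype σ] (M : ι → σ → Matrix (Fin 2) (Fin 2) ℂ) :
    tensorPi (fun i => ∑ s, M i s) = ∑ f : ι → σ, tensorPi fun i => M i (f i) := by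
  ext x y
  simp only [tensorPi, Matrix.of_apply, Matrix.sum_apply, Finset.prod_univ_sum,
    Fintype.piFinset_univ]

theorem tensorPi_single {ι : Type} [Fintype ι] (x y : Bits ι) :
    tensorPi (fun i => Matrix.single (x i) (y i) (1 : ℂ)) = Matrix.single x y 1 := by
  ext u v
  simp only [tensorPi, Matrix.of_apply, Matrix.single_apply]
  rw [Finset.prod_ite_zero]
  simp [funext_iff, forall_and]

theorem prod_letterProb {ι : Type} [Fintype ι] (p : ℝ) (E : PauliWord ι) :
    ∏ i, letterProb p (E i) = errorProb (Fintype.card ι) p (weight E) := by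
  simp only [letterProb, Finset.prod_ite, Finset.prod_const, errorProb, weight]
  congr 2
  have := Finset.card_filter_add_card_filter_not (s := Finset.univ) (fun i => E i = .I)
  rw [Finset.card_univ] at this
  simp only [ne_eq]
  omega

/-- Independent depolarizing noise applies the Pauli word `E` with probability `q_{wt E}`. -/
theorem tensorPower_depolarizing_apply (p : ℝ) (ρ : Op (Bits ι)) :
    tensorPower ι (depolarizing p) ρ = ∑ E : PauliWord ι,
      (errorProb (Fintype.card ι) p (weight E) : ℂ) • (pauliOp E * ρ * pauliOp E) := by
  have hsingle : ∀ y y' : Bits ι,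
      (tensorPi fun i => depolarizing p (Matrix.single (y i) (y' i) 1)) =
        ∑ E : PauliWord ι, (errorProb (Fintype.card ι) p (weight E) : ℂ) •
          (pauliOp E * Matrix.single y y' 1 * pauliOp E) := by
    intro y y'
    simp only [depolarizing_apply]
    rw [tensorPi_sum]
    refine Finset.sum_congr rfl fun E _ => ?_
    rw [tensorPi_smul, ← tensorPi_single, pauliOp, tensorPi_mul, tensorPi_mul,
      ← prod_letterProb, Complex.ofReal_prod]
  change ∑ y, ∑ y', ρ y y' • tensorPi (fun i => depolarizing p (Matrix.single (y i) (y' i) 1)) = _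
  simp only [hsingle, Finset.smul_sum]
  conv_rhs =>
    enter [2, E]
    rw [Matrix.matrix_eq_sum_single ρ]
  simp only [Finset.mul_sum, Finset.sum_mul, Finset.smul_sum]
  conv_lhs =>
    enter [2, y]
    rw [Finset.sum_comm]
  rw [Finset.sum_comm]
  refine Finset.sum_congr rfl fun E _ => Finset.sum_congr rfl fun y _ =>
    Finset.sum_congr rfl fun y' _ => ?_
  rw [smul_comm]
  congr 1
  rw [← Matrix.smul_mul, ← Matrix.mul_smul, Matrix.smul_single, smul_eq_mul, mul_one]

end Noise

variable {k c a : ℕ}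

theorem aliceOp_mul_mul_apply (E : PauliWord (AliceQubit k c a)) (ρ : Op (Joint k c a))
    (x y : Joint k c a) :
    (aliceOp E * ρ * aliceOp E) x y =
      (pauliOp E * (Matrix.of fun u v => ρ (u, x.2) (v, y.2)) * pauliOp E) x.1 y.1 := by
  simp [aliceOp, Matrix.mul_apply, Fintype.sum_prod_type, Matrix.one_apply, eq_comm]

theorem aliceNoise_apply (p : ℝ) (ρ : Op (Joint k c a)) :
    aliceNoise k c a p ρ = ∑ E : PauliWord (AliceQubit k c a),
      (errorProb (k + c + a) p (weight E) : ℂ) • (aliceOp E * ρ * aliceOp E) := by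
  have hcard : Fintype.card (AliceQubit k c a) = k + c + a := by
    simp [add_assoc]
  ext x y
  change tensorPower (AliceQubit k c a) (depolarizing p)
    (Matrix.of fun u v => ρ (u, x.2) (v, y.2)) x.1 y.1 = _
  rw [tensorPower_depolarizing_apply, hcard]
  simp only [Matrix.sum_apply, Matrix.smul_apply, aliceOp_mul_mul_apply]

/-- The sum of the squared moduli of the traces of the Kraus operators of `ρ ↦ tr (A ρ A†)`, the
partial trace over all qubits but the information qubits. There is one such operator for each basis
label `(u, y)` of the discarded qubits. -/
noncomputable def traceWeight (A : Matrix (Joint k c a) (Bits (Fin k)) ℂ) : ℂ :=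
  ∑ u : Bits (Fin c ⊕ Fin a), ∑ y : Bits (Fin c),
    (∑ i, A (Sum.elim i u, y) i) * star (∑ i, A (Sum.elim i u, y) i)

theorem sum_traceOut_single (A : Matrix (Joint k c a) (Bits (Fin k)) ℂ) :
    ∑ i, ∑ j, traceOut k c a (A * Matrix.single i j (1 : ℂ) * Aᴴ) i j = traceWeight A := by
  have hentry : ∀ i j : Bits (Fin k), traceOut k c a (A * Matrix.single i j (1 : ℂ) * Aᴴ) i j =
      ∑ u : Bits (Fin c ⊕ Fin a), ∑ y : Bits (Fin c),
        A (Sum.elim i u, y) i * star (A (Sum.elim j u, y) j) := by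
    intro i j
    change ∑ u : Bits (Fin c ⊕ Fin a), ∑ y : Bits (Fin c),
      (A * Matrix.single i j (1 : ℂ) * Aᴴ) (Sum.elim i u, y) (Sum.elim j u, y) = _
    refine Finset.sum_congr rfl fun u _ => Finset.sum_congr rfl fun y _ => ?_
    rw [Matrix.mul_apply, Finset.sum_eq_single j]
    · simp
    · intro l _ hl
      rw [Matrix.mul_single_apply_of_ne _ _ _ _ _ hl, zero_mul]
    · simp
  simp only [hentry, traceWeight, star_sum, Finset.sum_mul_sum]
  conv_lhs =>
    enter [2, i]
    rw [Finset.sum_comm]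
  rw [Finset.sum_comm]
  refine Finset.sum_congr rfl fun u _ => ?_
  conv_lhs =>
    enter [2, i]
    rw [Finset.sum_comm]
  rw [Finset.sum_comm]

/-- The amplitude operator of the error `E` and the measured syndrome `s`: encode, suffer `E`,
project on `s`, apply the representative of `s`, and undo the encoding unitary. -/
noncomputable def branchOp (U : Unitaries (AliceQubit k c a))
    (T : Syndrome c a → PauliWord (AliceQubit k c a)) (E : PauliWord (AliceQubit k c a))
    (s : Syndrome c a) : Matrix (Joint k c a) (Bits (Fin k)) ℂ :=
  ((U : Op (Bits (AliceQubit k c a))) ⊗ₖ (1 : Op (Bits (Fin c))))ᴴ *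
    aliceOp (T s) * syndromeProj U s *
    (aliceOp E * (((U : Op (Bits (AliceQubit k c a))) ⊗ₖ (1 : Op (Bits (Fin c)))) *
      initialState k c a))

theorem conjTranspose_aliceOp (E : PauliWord (AliceQubit k c a)) :
    (aliceOp E)ᴴ = aliceOp E := by
  rw [aliceOp, Matrix.conjTranspose_kronecker, Matrix.conjTranspose_one,
    ← Matrix.star_eq_conjTranspose, star_pauliOp]

theorem channelFidelity_code_eq_sum (U : Unitaries (AliceQubit k c a))
    (T : Syndrome c a → PauliWord (AliceQubit k c a)) (p : ℝ) :
    channelFidelity (decoder U T ∘ₗ aliceNoise k c a p ∘ₗ encoder U) =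
      ∑ E : PauliWord (AliceQubit k c a), (errorProb (k + c + a) p (weight E) : ℂ) *
        (((2 : ℂ) ^ k) ^ 2)⁻¹ * ∑ s, traceWeight (branchOp U T E s) := by
  have happly : ∀ ρ, (decoder U T ∘ₗ aliceNoise k c a p ∘ₗ encoder U) ρ =
      ∑ E : PauliWord (AliceQubit k c a), (errorProb (k + c + a) p (weight E) : ℂ) •
        ∑ s, traceOut k c a (branchOp U T E s * ρ * (branchOp U T E s)ᴴ) := by
    intro ρ
    rw [LinearMap.comp_apply, LinearMap.comp_apply, aliceNoise_apply, map_sum]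
    refine Finset.sum_congr rfl fun E _ => ?_
    rw [map_smul]
    congr 1
    rw [decoder, LinearMap.comp_apply]
    simp only [krausMap, encoder, LinearMap.coe_mk, AddHom.coe_mk, map_sum]
    refine Finset.sum_congr rfl fun s _ => ?_
    rw [Fintype.sum_unique]
    congr 1
    conv_rhs => rw [branchOp]
    conv_rhs => enter [2]; rw [Matrix.conjTranspose_mul]
    conv_rhs => enter [2, 1]; rw [Matrix.conjTranspose_mul, conjTranspose_aliceOp]
    simp only [Matrix.mul_assoc]
  rw [channelFidelity_eq]
  simp only [happly, Matrix.sum_apply, Matrix.smul_apply, smul_eq_mul, ← sum_traceOut_single]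
  conv_lhs =>
    enter [2, 2, i]
    rw [Finset.sum_comm]
  rw [Finset.sum_comm, Finset.mul_sum]
  refine Finset.sum_congr rfl fun E _ => ?_
  simp only [← Finset.mul_sum]
  rw [show (Fintype.card (Bits (Fin k)) : ℂ) = 2 ^ k by simp, mul_comm (_ : ℂ) (_⁻¹), mul_assoc]
  congr 2
  conv_lhs =>
    enter [2, i]
    rw [Finset.sum_comm]
  rw [Finset.sum_comm]

/-! ### Stabilizer generators and syndrome measurement -/

/-- The qubit of Alice on which the generator acts before conjugation by `U`. -/
def genQubit : GenLabel c a → AliceQubit k c a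
  | Sum.inl j => Sum.inr (Sum.inl j)
  | Sum.inr (Sum.inl j) => Sum.inr (Sum.inl j)
  | Sum.inr (Sum.inr i) => Sum.inr (Sum.inr i)

/-- The letter by which the generator acts on its qubit before conjugation by `U`. -/
def genLetter : GenLabel c a → PauliLetter
  | Sum.inl _ => .Z
  | Sum.inr (Sum.inl _) => .X
  | Sum.inr (Sum.inr _) => .Z

/-- The tensor factor of the generator on Bob's qubits. -/
def genBob : GenLabel c a → PauliWord (Fin c)
  | Sum.inl j => wordAt j .Z
  | Sum.inr (Sum.inl j) => wordAt j .X
  | Sum.inr (Sum.inr _) => fun _ => .I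

/-- The word on Alice's qubits of the generator before conjugation by `U`. -/
def genWord (k : ℕ) (j : GenLabel c a) : PauliWord (AliceQubit k c a) :=
  wordAt (genQubit j) (genLetter j)

theorem generator_eq (U : Unitaries (AliceQubit k c a)) (j : GenLabel c a) :
    generator U j = ((U * pauliUnitary (genWord k j) * U⁻¹ : Unitaries (AliceQubit k c a)) :
      Op (Bits (AliceQubit k c a))) ⊗ₖ pauliOp (genBob j) := by
  rcases j with j | j | i
  · rfl
  · rfl
  · rw [show genBob (Sum.inr (Sum.inr i) : GenLabel c a) = fun _ => .I from rfl, pauliOp_const_I]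
    rfl

theorem tensor_left_injective {α : Type} [Fintype α] (R : PauliWord (Fin c)) :
    Function.Injective fun M : Op α => M ⊗ₖ pauliOp R := by
  intro M N h
  obtain ⟨y, y', hy⟩ : ∃ y y', pauliOp R y y' ≠ 0 := by
    by_contra! h0
    exact pauliOp_ne_zero R (Matrix.ext h0)
  ext x x'
  have := congrFun (congrFun h (x, y)) (x', y')
  simpa [hy] using this

theorem commute_aliceOp_generator_iff (U : Unitaries (AliceQubit k c a))
    (E : PauliWord (AliceQubit k c a)) (j : GenLabel c a) :
    Commute (aliceOp E) (generator U j) ↔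
      Commute (pauliOp E) ((U * pauliUnitary (genWord k j) * U⁻¹ :
        Unitaries (AliceQubit k c a)) : Op (Bits (AliceQubit k c a))) := by
  rw [generator_eq, aliceOp, commute_iff_eq, commute_iff_eq, ← Matrix.mul_kronecker_mul,
    ← Matrix.mul_kronecker_mul, one_mul, mul_one]
  exact (tensor_left_injective (genBob j)).eq_iff

open Classical in
/-- The syndrome of a Pauli word on Alice's qubits. -/
noncomputable def syndromeOf (U : Unitaries (AliceQubit k c a))
    (E : PauliWord (AliceQubit k c a)) : Syndrome c a :=
  fun j => if Commute (aliceOp E) (generator U j) then 0 else 1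

theorem HasSyndrome.eq_syndromeOf {U : Unitaries (AliceQubit k c a)}
    {E : PauliWord (AliceQubit k c a)} {s : Syndrome c a} (h : HasSyndrome U E s) :
    s = syndromeOf U E := by
  funext j
  have := h j
  unfold syndromeOf
  split_ifs with h'
  · exact this.mpr h'
  · have h0 : s j ≠ 0 := fun h0 => h' (this.mp h0)
    omega

theorem pauliOp_mul_conj_eq_sign {U : Unitaries (AliceQubit k c a)} (hU : IsClifford U)
    (E : PauliWord (AliceQubit k c a)) (j : GenLabel c a) :
    pauliOp E * ((U * pauliUnitary (genWord k j) * U⁻¹ : Unitaries (AliceQubit k c a)) :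
        Op (Bits (AliceQubit k c a))) =
      (-1 : ℂ) ^ (syndromeOf U E j : ℕ) •
        (((U * pauliUnitary (genWord k j) * U⁻¹ : Unitaries (AliceQubit k c a)) :
          Op (Bits (AliceQubit k c a))) * pauliOp E) := by
  by_cases hc : Commute (aliceOp E) (generator U j)
  · have h := (commute_aliceOp_generator_iff U E j).mp hc
    simp only [syndromeOf, if_pos hc, Fin.val_zero, pow_zero, one_smul]
    exact h.eq
  · have h := mt (commute_aliceOp_generator_iff U E j).mpr hc
    simp only [syndromeOf, if_neg hc, Fin.val_one, pow_one]
    obtain ⟨z, hz, P, hP⟩ := hU _ (pauliUnitary_mem_pauliGroup (genWord k j))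
    rw [hP] at h ⊢
    have hcomm := pauliOp_mul_comm_sign E P
    rcases prod_sign_eq E P with h1 | h1 <;> rw [h1] at hcomm
    · rw [one_smul] at hcomm
      exact absurd (Commute.smul_right hcomm z) h
    · rw [Matrix.mul_smul, hcomm, Matrix.smul_mul, smul_comm]

theorem aliceOp_mul_generator {U : Unitaries (AliceQubit k c a)} (hU : IsClifford U)
    (E : PauliWord (AliceQubit k c a)) (j : GenLabel c a) :
    aliceOp E * generator U j =
      (-1 : ℂ) ^ (syndromeOf U E j : ℕ) • (generator U j * aliceOp E) := by
  rw [generator_eq, aliceOp, ← Matrix.mul_kronecker_mul, ← Matrix.mul_kronecker_mul, one_mul,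
    mul_one, pauliOp_mul_conj_eq_sign hU, Matrix.smul_kronecker]

/-- The amplitude `2^{-c/2}` of the initial state on each of its basis vectors. -/
noncomputable def ebitAmp (c : ℕ) : ℂ := ((1 / Real.sqrt 2 : ℝ) : ℂ) ^ c

theorem initialState_apply (x : Bits (AliceQubit k c a)) (y : Bits (Fin c)) (m : Bits (Fin k)) :
    initialState k c a (x, y) m =
      if x = Sum.elim m (Sum.elim y 0) then ebitAmp c else 0 := by
  have hprod : ∏ j, ebit (x (Sum.inr (Sum.inl j))) (y j) =
      if (fun j => x (Sum.inr (Sum.inl j))) = y then ebitAmp c else 0 := by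
    simp only [ebit]
    rw [Finset.prod_ite_zero]
    simp [funext_iff, ebitAmp]
  have hiff : x = Sum.elim m (Sum.elim y 0) ↔ (fun i => x (Sum.inl i)) = m ∧
      (fun j => x (Sum.inr (Sum.inl j))) = y ∧ (fun i => x (Sum.inr (Sum.inr i))) = 0 := by
    simp [funext_iff, Sum.forall]
  simp only [initialState, Matrix.of_apply, hprod, hiff]
  split_ifs <;> simp_all

/-- Amplitudes of a product Pauli operator applied to the initial state. On an ebit, Bob's letter
acts like its transpose on Alice's half. -/
theorem pauli_mul_initialState_apply (Q : PauliWord (AliceQubit k c a)) (R : PauliWord (Fin c))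
    (x : Bits (AliceQubit k c a)) (y : Bits (Fin c)) (m : Bits (Fin k)) :
    ((pauliOp Q ⊗ₖ pauliOp R) * initialState k c a) (x, y) m =
      ebitAmp c * (pauliOp (fun i => Q (Sum.inl i)) (fun i => x (Sum.inl i)) m *
        (∏ j, ((Q (Sum.inr (Sum.inl j))).mat * (R j).matᵀ) (x (Sum.inr (Sum.inl j))) (y j)) *
        ∏ i, (Q (Sum.inr (Sum.inr i))).mat (x (Sum.inr (Sum.inr i))) 0) := by
  rw [Matrix.mul_apply, Fintype.sum_prod_type, Finset.sum_comm]
  simp only [initialState_apply, Matrix.kroneckerMap_apply, mul_ite, mul_zero, Finset.sum_ite_eq',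
    Finset.mem_univ, if_true]
  simp only [Matrix.mul_apply, Finset.prod_univ_sum, Fintype.piFinset_univ, Finset.prod_mul_distrib,
    Matrix.transpose_apply]
  rw [Finset.mul_sum, Finset.sum_mul, Finset.mul_sum]
  refine Finset.sum_congr rfl fun y' _ => ?_
  simp only [pauliOp, tensorPi, Matrix.of_apply, Fintype.prod_sum_type, Sum.elim_inl, Sum.elim_inr,
    Pi.zero_apply]
  ring

/-- Words that act trivially on the information qubits, by a letter `L` on Alice's half and its
transpose on Bob's half of each ebit, and by `I` or `Z` on each ancilla fix the initial state. -/
theorem pauli_mul_initialState_eq_self {Q : PauliWord (AliceQubit k c a)} {R : PauliWord (Fin c)}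
    (hinfo : ∀ i, Q (Sum.inl i) = .I)
    (hebit : ∀ j, (Q (Sum.inr (Sum.inl j))).mat * (R j).matᵀ = 1)
    (hanc : ∀ i, Q (Sum.inr (Sum.inr i)) = .I ∨ Q (Sum.inr (Sum.inr i)) = .Z) :
    (pauliOp Q ⊗ₖ pauliOp R) * initialState k c a = initialState k c a := by
  have hone : initialState k c a =
      (pauliOp (fun _ : AliceQubit k c a => PauliLetter.I) ⊗ₖ
        pauliOp (fun _ : Fin c => PauliLetter.I)) * initialState k c a := by
    rw [pauliOp_const_I, pauliOp_const_I, Matrix.one_kronecker_one, Matrix.one_mul]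
  conv_rhs => rw [hone]
  ext ⟨x, y⟩ m
  rw [pauli_mul_initialState_apply, pauli_mul_initialState_apply]
  refine congrArg (ebitAmp c * ·) (congrArg₂ (· * ·) (congrArg₂ (· * ·) ?_ ?_) ?_)
  · simp only [hinfo]
  · refine Finset.prod_congr rfl fun j _ => ?_
    rw [hebit]
    simp [PauliLetter.mat]
  · refine Finset.prod_congr rfl fun i _ => ?_
    rcases hanc i with h | h <;> rw [h]
    generalize x (Sum.inr (Sum.inr i)) = b
    fin_cases b <;> simp [PauliLetter.mat, Matrix.one_apply]

theorem genWord_mul_initialState (j : GenLabel c a) :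
    (pauliOp (genWord k j) ⊗ₖ pauliOp (genBob j)) * initialState k c a =
      initialState k c a := by
  have hZ : (PauliLetter.Z).matᵀ = (PauliLetter.Z).mat := by
    ext i j; fin_cases i <;> fin_cases j <;> simp [PauliLetter.mat]
  have hX : (PauliLetter.X).matᵀ = (PauliLetter.X).mat := by
    ext i j; fin_cases i <;> fin_cases j <;> simp [PauliLetter.mat]
  have hI : (PauliLetter.I).matᵀ = (PauliLetter.I).mat := by simp [PauliLetter.mat]
  refine pauli_mul_initialState_eq_self ?_ ?_ ?_
  · rcases j with j | j | i <;> intro l <;> simp [genWord, genQubit, wordAt]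
  · intro l
    rcases j with j | j | i
    · by_cases h : l = j <;>
        simp [genWord, genQubit, genLetter, genBob, wordAt, h, hZ, hI, PauliLetter.mat_mul_self]
    · by_cases h : l = j <;>
        simp [genWord, genQubit, genLetter, genBob, wordAt, h, hX, hI, PauliLetter.mat_mul_self]
    · simp [genWord, genQubit, genLetter, genBob, wordAt, hI, PauliLetter.mat_mul_self]
  · intro l
    rcases j with j | j | i
    · simp [genWord, genQubit, wordAt]
    · simp [genWord, genQubit, wordAt]
    · by_cases h : l = i <;> simp [genWord, genQubit, genLetter, wordAt, h]

/-- The isometry that encodes the information qubits. -/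
noncomputable def encodingIsometry (U : Unitaries (AliceQubit k c a)) :
    Matrix (Joint k c a) (Bits (Fin k)) ℂ :=
  ((U : Op (Bits (AliceQubit k c a))) ⊗ₖ (1 : Op (Bits (Fin c)))) * initialState k c a

theorem generator_mul_encodingIsometry (U : Unitaries (AliceQubit k c a)) (j : GenLabel c a) :
    generator U j * encodingIsometry U = encodingIsometry U := by
  have hU : ((U⁻¹ : Unitaries (AliceQubit k c a)) : Op (Bits (AliceQubit k c a))) *
      (U : Op (Bits (AliceQubit k c a))) = 1 := by
    rw [← Submonoid.coe_mul, inv_mul_cancel, Submonoid.coe_one]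
  rw [generator_eq, encodingIsometry, ← Matrix.mul_assoc, ← Matrix.mul_kronecker_mul, mul_one,
    Submonoid.coe_mul, Submonoid.coe_mul, mul_assoc, hU, mul_one]
  conv_rhs => rw [← genWord_mul_initialState (k := k) j]
  rw [← Matrix.mul_assoc, ← Matrix.mul_kronecker_mul, one_mul]
  rfl

theorem prod_ofFn_mul_of_eigen {α β : Type} [Fintype α] [DecidableEq α] (W : Matrix α β ℂ) :
    ∀ {n : ℕ} (F : Fin n → Matrix α α ℂ) (μ : Fin n → ℂ), (∀ j, F j * W = μ j • W) →
      (List.ofFn F).prod * W = (∏ j, μ j) • W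
  | 0, F, μ, _ => by simp
  | n + 1, F, μ, h => by
    rw [List.ofFn_succ, List.prod_cons, Matrix.mul_assoc,
      prod_ofFn_mul_of_eigen W (fun j => F j.succ) (fun j => μ j.succ) fun j => h j.succ,
      Matrix.mul_smul, h 0, smul_smul, Fin.prod_univ_succ, mul_comm]

theorem projFactor_mul_error {U : Unitaries (AliceQubit k c a)} (hU : IsClifford U)
    (E : PauliWord (AliceQubit k c a)) (s : Syndrome c a) (j : GenLabel c a) :
    projFactor U s j * (aliceOp E * encodingIsometry U) =
      (if s j = syndromeOf U E j then (1 : ℂ) else 0) • (aliceOp E * encodingIsometry U) := by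
  have hgen : generator U j * (aliceOp E * encodingIsometry U) =
      (-1 : ℂ) ^ (syndromeOf U E j : ℕ) • (aliceOp E * encodingIsometry U) := by
    have h := aliceOp_mul_generator hU E j
    have hsq : (-1 : ℂ) ^ (syndromeOf U E j : ℕ) * (-1 : ℂ) ^ (syndromeOf U E j : ℕ) = 1 := by
      rw [← mul_pow]; simp
    have h' : generator U j * aliceOp E =
        (-1 : ℂ) ^ (syndromeOf U E j : ℕ) • (aliceOp E * generator U j) := by
      rw [h, smul_smul, hsq, one_smul]
    rw [← Matrix.mul_assoc, h', Matrix.smul_mul, Matrix.mul_assoc, generator_mul_encodingIsometry]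
  rw [projFactor, Matrix.smul_mul, Matrix.add_mul, Matrix.smul_mul, hgen, Matrix.one_mul, smul_smul]
  generalize aliceOp E * encodingIsometry U = W
  generalize s j = b
  generalize syndromeOf U E j = d
  nth_rewrite 1 [← one_smul ℂ W]
  rw [← add_smul, smul_smul]
  congr 1
  fin_cases b <;> fin_cases d <;> norm_num

/-- The error `E` on an encoded state is an eigenvector of the syndrome measurement, with the
syndrome of `E` as its certain outcome. -/
theorem syndromeProj_mul_error {U : Unitaries (AliceQubit k c a)} (hU : IsClifford U)
    (E : PauliWord (AliceQubit k c a)) (s : Syndrome c a) :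
    syndromeProj U s * (aliceOp E * encodingIsometry U) =
      if s = syndromeOf U E then aliceOp E * encodingIsometry U else 0 := by
  rw [syndromeProj, Matrix.mul_assoc, Matrix.mul_assoc,
    prod_ofFn_mul_of_eigen _ _ _ fun i => projFactor_mul_error hU E s (Sum.inr (Sum.inr i)),
    Matrix.mul_smul, Matrix.mul_smul,
    prod_ofFn_mul_of_eigen _ _ _ fun i => projFactor_mul_error hU E s (Sum.inr (Sum.inl i)),
    Matrix.mul_smul,
    prod_ofFn_mul_of_eigen _ _ _ fun i => projFactor_mul_error hU E s (Sum.inl i),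
    smul_smul, smul_smul]
  simp only [Finset.prod_ite_zero, Finset.prod_const_one]
  by_cases h : s = syndromeOf U E
  · simp [h]
  · rw [if_neg h]
    have h' : ¬ ((∀ i, s (Sum.inl i) = syndromeOf U E (Sum.inl i)) ∧
        (∀ i, s (Sum.inr (Sum.inl i)) = syndromeOf U E (Sum.inr (Sum.inl i))) ∧
        ∀ i, s (Sum.inr (Sum.inr i)) = syndromeOf U E (Sum.inr (Sum.inr i))) := by
      rintro ⟨h1, h2, h3⟩
      exact h (funext fun j => by rcases j with j | j | i <;> simp_all)
    simp only [Finset.mem_univ, true_implies]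
    split_ifs <;> simp_all

/-! ### The isotropic subgroup -/

/-- The word with `Z` at the ancillas in `t` and identities elsewhere. -/
def zWord (k c : ℕ) (t : Finset (Fin a)) : PauliWord (AliceQubit k c a) :=
  Sum.elim (fun _ => .I) (Sum.elim (fun _ => .I) fun i => if i ∈ t then .Z else .I)

theorem pauliUnitary_zWord_mul (t t' : Finset (Fin a)) :
    pauliUnitary (zWord k c t) * pauliUnitary (zWord k c t') =
      pauliUnitary (zWord k c (symmDiff t t')) := by
  refine Subtype.ext ?_
  change pauliOp (zWord k c t) * pauliOp (zWord k c t') = pauliOp (zWord k c (symmDiff t t'))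
  simp only [pauliOp, tensorPi_mul]
  congr 1
  funext i
  rcases i with i | i | i
  · exact PauliLetter.mat_mul_self _
  · exact PauliLetter.mat_mul_self _
  · have hI : PauliLetter.I.mat = 1 := rfl
    by_cases h : i ∈ t <;> by_cases h' : i ∈ t' <;>
      simp [zWord, Finset.mem_symmDiff, h, h', PauliLetter.mat_mul_self, hI]

theorem pauliUnitary_zWord_empty : pauliUnitary (zWord k c (∅ : Finset (Fin a))) = 1 := by
  refine Subtype.ext ?_
  change pauliOp (zWord k c (∅ : Finset (Fin a))) = 1
  rw [← pauliOp_const_I]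
  congr 1
  funext i
  rcases i with i | i | i <;> simp [zWord]

theorem zWord_singleton (i : Fin a) :
    zWord k c {i} = wordAt (Sum.inr (Sum.inr i)) PauliLetter.Z := by
  funext l
  rcases l with l | l | l
  · simp [zWord, wordAt]
  · simp [zWord, wordAt]
  · by_cases h : l = i <;> simp [zWord, wordAt, h]

/-- The isotropic subgroup consists of the conjugates of products of ancilla `Z`s. -/
theorem mem_isotropicSubgroup_iff (U : Unitaries (AliceQubit k c a))
    (g : Unitaries (AliceQubit k c a)) :
    g ∈ isotropicSubgroup U ↔
      ∃ t : Finset (Fin a), g = U * pauliUnitary (zWord k c t) * U⁻¹ := by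
  constructor
  · intro hg
    induction hg using Subgroup.closure_induction with
    | mem x hx =>
      obtain ⟨i, rfl⟩ := hx
      exact ⟨{i}, by rw [zWord_singleton]; rfl⟩
    | one => exact ⟨∅, by rw [pauliUnitary_zWord_empty]; group⟩
    | mul x y _ _ hx hy =>
      obtain ⟨t, rfl⟩ := hx
      obtain ⟨t', rfl⟩ := hy
      refine ⟨symmDiff t t', ?_⟩
      rw [← pauliUnitary_zWord_mul]
      group
    | inv x _ hx =>
      obtain ⟨t, rfl⟩ := hx
      refine ⟨t, inv_eq_of_mul_eq_one_right ?_⟩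
      have h : pauliUnitary (zWord k c t) * pauliUnitary (zWord k c t) = 1 := by
        rw [pauliUnitary_zWord_mul, symmDiff_self]
        exact pauliUnitary_zWord_empty
      calc _ = U * (pauliUnitary (zWord k c t) * pauliUnitary (zWord k c t)) * U⁻¹ := by group
        _ = 1 := by rw [h]; group
  · rintro ⟨t, rfl⟩
    induction t using Finset.induction_on with
    | empty =>
      rw [pauliUnitary_zWord_empty, mul_one, mul_inv_cancel]
      exact one_mem _
    | insert i t hi ih =>
      have hsplit : insert i t = symmDiff {i} t := by
        ext l
        by_cases h : l = i <;> simp [Finset.mem_symmDiff, h, hi]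
      have hprod : U * pauliUnitary (zWord k c (insert i t)) * U⁻¹ =
          (U * pauliUnitary (zWord k c {i}) * U⁻¹) *
            (U * pauliUnitary (zWord k c t) * U⁻¹) := by
        rw [hsplit, ← pauliUnitary_zWord_mul]
        group
      rw [hprod]
      refine mul_mem (Subgroup.subset_closure ⟨i, ?_⟩) ih
      rw [zWord_singleton]
      rfl

/-- A word commutes with all unconjugated generators exactly if it is trivial on the ebits and `I`
or `Z` on each ancilla. -/
theorem commute_genWord_iff (Q : PauliWord (AliceQubit k c a)) :
    (∀ j : GenLabel c a, Commute (pauliOp Q) (pauliOp (genWord k j))) ↔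
      (∀ j, Q (Sum.inr (Sum.inl j)) = .I) ∧
        ∀ i, Q (Sum.inr (Sum.inr i)) = .I ∨ Q (Sum.inr (Sum.inr i)) = .Z := by
  have hZ : ∀ L : PauliLetter, L.sign .Z = 1 ↔ L = .I ∨ L = .Z := by
    intro L; cases L <;> norm_num [PauliLetter.sign] <;> decide
  have hX : ∀ L : PauliLetter, L.sign .X = 1 ↔ L = .I ∨ L = .X := by
    intro L; cases L <;> norm_num [PauliLetter.sign] <;> decide
  simp only [genWord, commute_pauliOp_wordAt_iff, Sum.forall, genQubit, genLetter, hZ, hX]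
  constructor
  · rintro ⟨h1, h2, h3⟩
    refine ⟨fun j => ?_, h3⟩
    rcases h1 j with h | h
    · exact h
    · rcases h2 j with h' | h'
      · exact h'
      · rw [h] at h'; cases h'
  · rintro ⟨h1, h3⟩
    exact ⟨fun j => Or.inl (h1 j), fun j => Or.inl (h1 j), h3⟩

theorem exists_eq_zWord {Q : PauliWord (AliceQubit k c a)} (hinfo : ∀ i, Q (Sum.inl i) = .I)
    (hebit : ∀ j, Q (Sum.inr (Sum.inl j)) = .I)
    (hanc : ∀ i, Q (Sum.inr (Sum.inr i)) = .I ∨ Q (Sum.inr (Sum.inr i)) = .Z) :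
    ∃ t : Finset (Fin a), Q = zWord k c t := by
  refine ⟨Finset.univ.filter fun i => Q (Sum.inr (Sum.inr i)) = .Z, ?_⟩
  funext l
  rcases l with l | l | l
  · simp [zWord, hinfo]
  · simp [zWord, hebit]
  · rcases hanc l with h | h <;> simp [zWord, h]

/-! ### The error left after correction -/

theorem commute_coe_iff {ι : Type} [Fintype ι] [DecidableEq ι] (u v : Unitaries ι) :
    Commute (u : Op (Bits ι)) (v : Op (Bits ι)) ↔ Commute u v := by
  rw [commute_iff_eq, commute_iff_eq, Subtype.ext_iff]
  rfl

theorem commute_conj_iff {G : Type*} [Group G] (u x y : G) :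
    Commute (u * x * u⁻¹) (u * y * u⁻¹) ↔ Commute x y := by
  rw [commute_iff_eq, commute_iff_eq]
  constructor
  · intro h
    have h' : u * (x * y) * u⁻¹ = u * (y * x) * u⁻¹ := by
      simpa [mul_assoc] using h
    exact mul_left_cancel (mul_right_cancel h')
  · intro h
    calc _ = u * (x * y) * u⁻¹ := by group
      _ = u * (y * x) * u⁻¹ := by rw [h]
      _ = _ := by group

/-- The representative of the syndrome of `E` turns `E` into the conjugate of a word that commutes
with all unconjugated generators, up to phase. -/
theorem exists_residual {U : Unitaries (AliceQubit k c a)} (hU : IsClifford U)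
    {T : Syndrome c a → PauliWord (AliceQubit k c a)} (hT : IsSyndromeReps U T)
    (E : PauliWord (AliceQubit k c a)) :
    ∃ z : ℂ, z ^ 4 = 1 ∧ ∃ Q : PauliWord (AliceQubit k c a),
      pauliOp (T (syndromeOf U E)) * pauliOp E =
        z • ((U * pauliUnitary Q * U⁻¹ : Unitaries (AliceQubit k c a)) :
          Op (Bits (AliceQubit k c a))) ∧
      ∀ j : GenLabel c a, Commute (pauliOp Q) (pauliOp (genWord k j)) := by
  set P := T (syndromeOf U E) with hP
  obtain ⟨z, hz, Q, hQ⟩ := hU.inv_mul_mul_mem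
    (mul_mem (pauliUnitary_mem_pauliGroup P) (pauliUnitary_mem_pauliGroup E))
  have hz0 : z ≠ 0 := by rintro rfl; simp at hz
  have heq : pauliOp P * pauliOp E =
      z • ((U * pauliUnitary Q * U⁻¹ : Unitaries (AliceQubit k c a)) :
        Op (Bits (AliceQubit k c a))) := by
    have h : pauliUnitary P * pauliUnitary E =
        U * (U⁻¹ * (pauliUnitary P * pauliUnitary E) * U) * U⁻¹ := by group
    have h' := congrArg (Subtype.val) h
    rw [Submonoid.coe_mul, Submonoid.coe_mul, Submonoid.coe_mul, hQ, Matrix.mul_smul,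
      Matrix.smul_mul] at h'
    exact h'
  refine ⟨z, hz, Q, heq, fun j => ?_⟩
  have hsyn : syndromeOf U P = syndromeOf U E := ((hT.1 _).eq_syndromeOf).symm
  have hcomm : Commute (pauliOp P * pauliOp E)
      ((U * pauliUnitary (genWord k j) * U⁻¹ : Unitaries (AliceQubit k c a)) :
        Op (Bits (AliceQubit k c a))) := by
    have hsq : (-1 : ℂ) ^ (syndromeOf U E j : ℕ) * (-1 : ℂ) ^ (syndromeOf U E j : ℕ) = 1 := by
      rw [← mul_pow]; simp
    rw [commute_iff_eq, mul_assoc, pauliOp_mul_conj_eq_sign hU, mul_smul_comm, ← mul_assoc,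
      pauliOp_mul_conj_eq_sign hU, hsyn, smul_mul_assoc, smul_smul, hsq, one_smul, mul_assoc]
  rw [heq, Commute.smul_left_iff₀ hz0, commute_coe_iff, commute_conj_iff, ← commute_coe_iff] at hcomm
  exact hcomm

theorem mem_repsTimesIsotropic_iff {U : Unitaries (AliceQubit k c a)}
    {T : Syndrome c a → PauliWord (AliceQubit k c a)} (hT : IsSyndromeReps U T)
    {E Q : PauliWord (AliceQubit k c a)} {z : ℂ} (hz : z ^ 4 = 1)
    (hQ : pauliOp (T (syndromeOf U E)) * pauliOp E =
        z • ((U * pauliUnitary Q * U⁻¹ : Unitaries (AliceQubit k c a)) :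
          Op (Bits (AliceQubit k c a))))
    (hcomm : ∀ j : GenLabel c a, Commute (pauliOp Q) (pauliOp (genWord k j))) :
    E ∈ repsTimesIsotropic U T ↔ (fun i => Q (Sum.inl i)) = fun _ => .I := by
  have hz0 : z ≠ 0 := by rintro rfl; simp at hz
  have hcomm' := (commute_genWord_iff Q).mp hcomm
  constructor
  · rintro ⟨s, g, hg, w, hw, hE⟩
    have hw0 : w ≠ 0 := by rintro rfl; simp at hw
    obtain ⟨t, rfl⟩ := (mem_isotropicSubgroup_iff U g).mp hg
    -- Elements of the isotropic subgroup do not change the syndrome, so `s` is that of `E`.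
    have hs : s = syndromeOf U E := by
      refine HasSyndrome.eq_syndromeOf fun j => ?_
      have hgj : Commute (U * pauliUnitary (zWord k c t) * U⁻¹)
          (U * pauliUnitary (genWord k j) * U⁻¹) := by
        rw [commute_conj_iff, ← commute_coe_iff]
        refine (commute_genWord_iff (zWord k c t)).mpr ⟨fun j => rfl, fun i => ?_⟩ j
        by_cases h : i ∈ t <;> simp [zWord, h]
      rw [hT.1 s j, commute_aliceOp_generator_iff, commute_aliceOp_generator_iff,
        ← Commute.smul_left_iff₀ (a := w) (x := pauliOp E) hw0, ← hE]
      change Commute ((pauliUnitary (T s) : Unitaries (AliceQubit k c a)) :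
          Op (Bits (AliceQubit k c a))) _ ↔ Commute ((pauliUnitary (T s) *
        (U * pauliUnitary (zWord k c t) * U⁻¹) : Unitaries (AliceQubit k c a)) :
          Op (Bits (AliceQubit k c a))) _
      rw [commute_coe_iff, commute_coe_iff]
      refine ⟨fun h => h.mul_left hgj, fun h => ?_⟩
      have := h.mul_left hgj.inv_left
      rwa [mul_inv_cancel_right] at this
    have h1 : w • (pauliOp (T s) * pauliOp E) =
        ((U * pauliUnitary (zWord k c t) * U⁻¹ : Unitaries (AliceQubit k c a)) :
          Op (Bits (AliceQubit k c a))) := by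
      rw [← mul_smul_comm, ← hE, ← mul_assoc, pauliOp_mul_self, one_mul]
    rw [hs, hQ, smul_smul] at h1
    have h2 : ((U⁻¹ : Unitaries (AliceQubit k c a)) : Op (Bits (AliceQubit k c a))) *
        (U : Op (Bits (AliceQubit k c a))) = 1 := by
      rw [← Submonoid.coe_mul, inv_mul_cancel, Submonoid.coe_one]
    have h3 := congrArg (fun M => ((U⁻¹ : Unitaries (AliceQubit k c a)) :
      Op (Bits (AliceQubit k c a))) * M * (U : Op (Bits (AliceQubit k c a)))) h1
    simp only [Submonoid.coe_mul, mul_smul_comm, smul_mul_assoc, mul_assoc, h2, mul_one] at h3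
    simp only [← mul_assoc, h2, one_mul] at h3
    have h4 : zWord k c t = Q := eq_of_pauliOp_eq_smul h3.symm
    funext i
    rw [← h4]
    rfl
  · intro hinfo
    obtain ⟨t, rfl⟩ := exists_eq_zWord (congrFun hinfo) hcomm'.1 hcomm'.2
    refine ⟨syndromeOf U E, _, (mem_isotropicSubgroup_iff U _).mpr ⟨t, rfl⟩, z⁻¹,
      by rw [inv_pow, hz, inv_one], ?_⟩
    rw [eq_inv_smul_iff₀ hz0, ← mul_smul_comm, ← hQ, ← mul_assoc, pauliOp_mul_self, one_mul]

theorem branchOp_eq {U : Unitaries (AliceQubit k c a)} (hU : IsClifford U)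
    {T : Syndrome c a → PauliWord (AliceQubit k c a)}
    {E Q : PauliWord (AliceQubit k c a)} {z : ℂ}
    (hQ : pauliOp (T (syndromeOf U E)) * pauliOp E =
        z • ((U * pauliUnitary Q * U⁻¹ : Unitaries (AliceQubit k c a)) :
          Op (Bits (AliceQubit k c a)))) (s : Syndrome c a) :
    branchOp U T E s = if s = syndromeOf U E then
      z • ((pauliOp Q ⊗ₖ pauliOp (fun _ : Fin c => PauliLetter.I)) * initialState k c a)
      else 0 := by
  have h := syndromeProj_mul_error hU E s
  rw [encodingIsometry] at h
  rw [branchOp, Matrix.mul_assoc, h]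
  split_ifs with hs
  · have hUU : (U : Op (Bits (AliceQubit k c a)))ᴴ * (U : Op (Bits (AliceQubit k c a))) = 1 := by
      rw [← Matrix.star_eq_conjTranspose]
      exact Matrix.mem_unitaryGroup_iff'.mp U.2
    rw [hs, aliceOp, aliceOp, Matrix.conjTranspose_kronecker, Matrix.conjTranspose_one,
      ← Matrix.mul_assoc, ← Matrix.mul_assoc, ← Matrix.mul_kronecker_mul,
      ← Matrix.mul_kronecker_mul, ← Matrix.mul_kronecker_mul, mul_assoc _ (pauliOp _) (pauliOp E),
      hQ, pauliOp_const_I, ← Matrix.smul_mul, ← Matrix.smul_kronecker]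
    congr 2
    · rw [mul_smul_comm, smul_mul_assoc, Submonoid.coe_mul, Submonoid.coe_mul,
        Matrix.UnitaryGroup.inv_val, Matrix.star_eq_conjTranspose, mul_assoc, mul_assoc, mul_assoc,
        hUU, mul_one, ← mul_assoc, hUU, one_mul]
      rfl
    · simp
  · rw [Matrix.mul_zero]

theorem ebitAmp_mul_star (c : ℕ) : (2 : ℂ) ^ c * (ebitAmp c * star (ebitAmp c)) = 1 := by
  have h : ((1 / Real.sqrt 2 : ℝ) : ℂ) * ((1 / Real.sqrt 2 : ℝ) : ℂ) = 2⁻¹ := by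
    rw [← Complex.ofReal_mul, div_mul_div_comm, Real.mul_self_sqrt (by norm_num)]
    simp
  have hstar : star (ebitAmp c) = ebitAmp c := by
    rw [ebitAmp, star_pow]
    congr 1
    exact Complex.conj_ofReal _
  rw [hstar, ebitAmp, ← mul_pow, h, ← mul_pow]
  norm_num

/-- A residual word that acts on the ebits trivially and on the ancillas by `I` or `Z` contributes
to the fidelity the squared trace of its restriction to the information qubits, which vanishes
unless the restriction is the identity. -/
theorem traceWeight_residual {Q : PauliWord (AliceQubit k c a)} {z : ℂ} (hz : z ^ 4 = 1)
    (hebit : ∀ j, Q (Sum.inr (Sum.inl j)) = .I)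
    (hanc : ∀ i, Q (Sum.inr (Sum.inr i)) = .I ∨ Q (Sum.inr (Sum.inr i)) = .Z) :
    traceWeight (z • ((pauliOp Q ⊗ₖ pauliOp (fun _ : Fin c => PauliLetter.I)) *
      initialState k c a)) =
      if (fun i => Q (Sum.inl i)) = fun _ => .I then ((2 : ℂ) ^ k) ^ 2 else 0 := by
  have hzz : z * star z = 1 := by
    have hn : ‖z‖ = 1 := Complex.norm_eq_one_of_pow_eq_one hz (by norm_num)
    have := Complex.mul_conj z
    rw [Complex.normSq_eq_norm_sq, hn] at this
    simpa using this
  set τ := (pauliOp fun i => Q (Sum.inl i)).trace with hτ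
  have hsum : ∀ (u : Bits (Fin c ⊕ Fin a)) (y : Bits (Fin c)),
      ∑ i, (z • ((pauliOp Q ⊗ₖ pauliOp (fun _ : Fin c => PauliLetter.I)) *
        initialState k c a)) (Sum.elim i u, y) i =
        if u = Sum.elim y 0 then z * (ebitAmp c * τ) else 0 := by
    intro u y
    have he : ∏ j, ((Q (Sum.inr (Sum.inl j))).mat * (PauliLetter.I.mat)ᵀ) (u (Sum.inl j)) (y j) =
        if (fun j => u (Sum.inl j)) = y then (1 : ℂ) else 0 := by
      simp only [hebit, PauliLetter.mat, Matrix.transpose_one, mul_one, Matrix.one_apply]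
      rw [Finset.prod_ite_zero]
      simp [funext_iff]
    have ha : ∏ i, (Q (Sum.inr (Sum.inr i))).mat (u (Sum.inr i)) 0 =
        if (fun i => u (Sum.inr i)) = 0 then (1 : ℂ) else 0 := by
      have hletter : ∀ i, (Q (Sum.inr (Sum.inr i))).mat (u (Sum.inr i)) 0 =
          if u (Sum.inr i) = 0 then (1 : ℂ) else 0 := by
        intro i
        generalize u (Sum.inr i) = b
        rcases hanc i with h | h <;> rw [h] <;> fin_cases b <;> simp [PauliLetter.mat, Matrix.one_apply]
      simp only [hletter]
      rw [Finset.prod_ite_zero]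
      simp [funext_iff]
    have hiff : u = Sum.elim y 0 ↔
        (fun j => u (Sum.inl j)) = y ∧ (fun i => u (Sum.inr i)) = 0 := by
      simp [funext_iff, Sum.forall]
    simp only [Matrix.smul_apply, smul_eq_mul, pauli_mul_initialState_apply, Sum.elim_inl,
      Sum.elim_inr, he, ha, hiff]
    simp only [← Finset.mul_sum, ← Finset.sum_mul]
    have ht : ∑ i : Bits (Fin k), pauliOp (fun i => Q (Sum.inl i)) i i = τ := rfl
    rw [ht]
    split_ifs <;> simp_all
  have hτ2 : τ * star τ = if (fun i => Q (Sum.inl i)) = fun _ => .I then ((2 : ℂ) ^ k) ^ 2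
      else 0 := by
    rw [hτ, trace_pauliOp, Fintype.card_fin]
    split_ifs
    · simp [pow_two]
    · simp
  simp only [traceWeight, hsum]
  rw [Finset.sum_comm]
  simp only [apply_ite star, star_zero, mul_ite, ite_mul, mul_zero, zero_mul, Finset.sum_ite_eq',
    Finset.mem_univ, if_true, Finset.sum_const, Finset.card_univ, Fintype.card_pi,
    Fintype.card_fin, Finset.prod_const, nsmul_eq_mul, star_mul', Nat.cast_pow, Nat.cast_ofNat]
  rw [← hτ2]
  calc _ = (z * star z) * ((2 : ℂ) ^ c * (ebitAmp c * star (ebitAmp c))) * (τ * star τ) := by ring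
    _ = _ := by rw [hzz, ebitAmp_mul_star, one_mul, one_mul]

/-! ### Counting errors by weight -/

open Classical in
theorem weightEnumerator_eq_sum {ι : Type} [Fintype ι] [DecidableEq ι]
    (A : Set (PauliWord ι)) (q : ℕ → ℝ) :
    weightEnumerator A q = ∑ E : PauliWord ι, if E ∈ A then q (weight E) else 0 := by
  rw [← Finset.sum_filter, weightEnumerator,
    ← Finset.sum_fiberwise_of_maps_to (g := weight) (t := Finset.range (Fintype.card ι + 1))
      fun E _ => Finset.mem_range_succ_iff.mpr (Finset.card_le_univ _)]
  refine Finset.sum_congr rfl fun w _ => ?_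
  rw [Finset.sum_congr (g := fun _ => q w) rfl
      fun E hE => congrArg q (Finset.mem_filter.mp hE).2,
    Finset.sum_const, nsmul_eq_mul, ← Set.ncard_coe_finset]
  congr 3
  ext E
  simp

end EAQEC

theorem mainTheorem6 (k c a : ℕ)
    (U : EAQEC.Unitaries (EAQEC.AliceQubit k c a)) (hU : EAQEC.IsClifford U)
    (T : EAQEC.Syndrome c a → EAQEC.PauliWord (EAQEC.AliceQubit k c a))
    (hT : EAQEC.IsSyndromeReps U T)
    (p : ℝ) (hp0 : 0 ≤ p) (hp1 : p ≤ 1) :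
    EAQEC.channelFidelity
        (EAQEC.decoder U T ∘ₗ EAQEC.aliceNoise k c a p ∘ₗ EAQEC.encoder U) =
      ((EAQEC.weightEnumerator (EAQEC.repsTimesIsotropic U T)
        (EAQEC.errorProb (k + c + a) p) : ℝ) : ℂ) := by
  rw [EAQEC.channelFidelity_code_eq_sum, EAQEC.weightEnumerator_eq_sum, Complex.ofReal_sum]
  refine Finset.sum_congr rfl fun E _ => ?_
  obtain ⟨z, hz, Q, hQ, hcomm⟩ := EAQEC.exists_residual hU hT E
  have hcomm' := (EAQEC.commute_genWord_iff Q).mp hcomm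
  -- Only the branch whose outcome is the syndrome of `E` contributes.
  rw [Finset.sum_eq_single (EAQEC.syndromeOf U E), EAQEC.branchOp_eq hU hQ, if_pos rfl,
    EAQEC.traceWeight_residual hz hcomm'.1 hcomm'.2]
  · simp only [EAQEC.mem_repsTimesIsotropic_iff hT hz hQ hcomm]
    split_ifs
    · rw [mul_assoc, inv_mul_cancel₀ (pow_ne_zero _ (pow_ne_zero _ two_ne_zero)), mul_one]
    · simp
  · intro s _ hs
    rw [EAQEC.branchOp_eq hU hQ, if_neg hs]
    simp [EAQEC.traceWeight]
  · intro h
    exact absurd (Finset.mem_univ _) h
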